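/- Let $B=\{B(t):t\in\mathbb R\}$ be a two-sided fractional Brownian motion with Hurst parameter $1/6$, i.e. a centered Gaussian process with $E[B(s)B(t)]=\frac12\left(|t|^{1/3}+|s|^{1/3}-|t-s|^{1/3}\right)$ for $s,t\in\mathbb R$. For a positive integer $n$ and $t\ge 0$ let $$W_n(t)=\sum_{j=1}^{\lfloor nt\rfloor}\left(B(j/n)-B((j-1)/n)\right)^3 .$$ For $L\in(0,\infty)$, $m\in\mathbb Z$ and $x\in[0,1]$ let $$f_{m,L}(x)=\left(|x-m+1|^{1/3}+|x-m-L|^{1/3}-|x-m|^{1/3}-|x-m+1-L|^{1/3}\right)^3,\qquad f_L(x)=\sum_{m\in\mathbb Z}f_{m,L}(x),$$ and let $\widehat f_L(x)=f_L(x-\lfloor x\rfloor)$ for $x\in\mathbb R$. Let $\{a_n\}$ and $\{b_n\}$ be strictly increasing sequences of positive integers, let $L_n=b_n/a_n$, and suppose that $L_n\to L\in(0,\infty)$. Let $I=\{n:L_n=L\}$ and $c_n=\gcd(a_n,b_n)$. Then the series defining $f_L$ converges absolutely at every point of $[0,1]$, $f_L$ is continuous on $[0,1]$, the random variables $W_{a_n}(t)W_{b_n}(t)$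 are integrable for all $n$ and all $t\ge0$, and the following hold. (i) If $I^c$ is finite, then $L\in\mathbb Q$ and, for all $t\ge 0$, $$\lim_{n\to\infty}E[W_{a_n}(t)W_{b_n}(t)]=\frac{3t}{4p}\sum_{j=1}^q f_L(j/q),$$ where $L=p/q$ with $p,q$ relatively prime positive integers. (ii) If $I$ is finite, then $$\lim_{n\to\infty}E[W_{a_n}(1)W_{b_n}(1)]=\frac{3}{4L}\int_0^1 f_L(x)\,dx.$$ (iii) If $I$ is finite and $c_n\to\infty$, then, for all $t\ge 0$, $$\lim_{n\to\infty}E[W_{a_n}(t)W_{b_n}(t)]=\frac{3t}{4L}\int_0^1 f_L(x)\,dx.$$ (iv) If there is an integer $k\ge 0$ such that $b_n\equiv k \pmod{a_n}$ for all $n$, then, for all $t\ge 0$, $$\lim_{n\to\infty}E[W_{a_n}(t)W_{b_n}(t)]=\frac{3}{4L}\int_0^t\widehat f_L(kx)\,dx.$$ -/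

import Mathlib

open MeasureTheory ProbabilityTheory Filter Topology

/-- `B`, indexed by all of `ℝ`, is a (two-sided) fractional Brownian motion with Hurst parameter
`1/6` under `P`: a centered Gaussian process with
`E[B(s) B(t)] = (|t|^(1/3) + |s|^(1/3) - |t - s|^(1/3)) / 2`. -/
structure IsFBMSixth {Ω : Type*} [MeasurableSpace Ω] (P : Measure Ω) (B : ℝ → Ω → ℝ) : Prop where
  gaussian : IsGaussianProcess B P
  centered : ∀ t : ℝ, ∫ ω, B t ω ∂P = 0
  covariance : ∀ s t : ℝ, ∫ ω, B s ω * B t ω ∂P =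
    (|t| ^ (1 / 3 : ℝ) + |s| ^ (1 / 3 : ℝ) - |t - s| ^ (1 / 3 : ℝ)) / 2

/-- The signed cubic variation `W_n(t) = ∑_{j=1}^{⌊nt⌋} (B(j/n) - B((j-1)/n))^3`, for `t ≥ 0`. -/
noncomputable def cubicVar {Ω : Type*} (B : ℝ → Ω → ℝ) (n : ℕ) (t : ℝ) (ω : Ω) : ℝ :=
  ∑ j ∈ Finset.Icc 1 ⌊(n : ℝ) * t⌋₊,
    (B ((j : ℝ) / (n : ℝ)) ω - B (((j : ℝ) - 1) / (n : ℝ)) ω) ^ 3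

/-- `Φ(s,t,u,v)`, which equals `2 E[(B(t) - B(s)) (B(v) - B(u))]`. -/
noncomputable def fbmPhi (s t u v : ℝ) : ℝ :=
  |t - u| ^ (1 / 3 : ℝ) + |s - v| ^ (1 / 3 : ℝ) - |s - u| ^ (1 / 3 : ℝ) - |t - v| ^ (1 / 3 : ℝ)

/-- `f_{m,L}(x) = Φ(x, x + 1, m, m + L)^3`, used for `x ∈ [0,1]`. -/
noncomputable def fTerm (L : ℝ) (m : ℤ) (x : ℝ) : ℝ :=
  fbmPhi x (x + 1) (m : ℝ) ((m : ℝ) + L) ^ 3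

/-- `f_L = ∑_{m ∈ ℤ} f_{m,L}` on `[0,1]`. -/
noncomputable def fSum (L x : ℝ) : ℝ := ∑' m : ℤ, fTerm L m x

/-- The extension of `f_L` from `[0,1)` to `ℝ` with period one: `x ↦ f_L(x - ⌊x⌋)`. -/
noncomputable def fHat (L x : ℝ) : ℝ := fSum L (x - (⌊x⌋ : ℝ))

/-!
The product of the cubes of two centered Gaussian increments with covariance `ρ` has mean `6 ρ³` plus
a multiple of `ρ` (Wick's formula, `HasGaussianLaw.integral_cube_mul_cube`, read off from the sixth
moment of a linear combination). Summed over both partitions, the terms linear in `ρ` telescope to a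
bounded covariance times `(ab)^(-1/3)`, which vanishes in the limit. By scaling, with `ℓ = b / a`,
the terms `6 ρ³` are `3 / (4 b)` times the values `g_ℓ(j - ℓ i)` of the kernel
`g_L(u) = Φ(u, u + 1, 0, L)³`; this is `IsFBMSixth.integral_cubicVar_mul`.

The kernel is `O(1 / (1 + u²))`, since already the cubed unit increments of `|u|^(1/3)` are. Hence
`f_L(x) = ∑ m, g_L(x - m)` converges, is jointly continuous in `(L, x)` and has period one in `x`.
It also satisfies `f_L(L - x) = f_L(x)`. Completing, for fixed `i`, the sum over `j` to all of `ℤ`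
gives `f_ℓ(-ℓ i) = f_ℓ(ℓ (i + 1))`; the row `i` loses `O(1 / (1 + i) + 1 / (⌊at⌋ - i))`, which is
negligible on average by Cesàro's theorem. So (`IsFBMSixth.tendsto_integral_of_average`) the limit
is `3 / (4 L)` times that of the averages `(1 / a) ∑_{i ≤ at} f_L((b / a) i)`.

What remains is the distribution modulo one of the points `(b / a) i`. With `b / a = β / α` in
lowest terms, the points of one period are the fractions `i / α`, so up to an error `O(α / a)`, or
exactly when whole periods are summed, the average is `t / α * ∑_{i ≤ α} f_L(i / α)`
(`tendsto_average_of_reduced`). If `b / a = L` eventually, `α` is constant. If `b / a ≠ L`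
eventually, then `α → ∞` (`tendsto_reduced_denom`), because fractions with a bounded denominator
form a discrete set, and a Riemann sum appears. If `b ≡ k` modulo `a`, then
`f_L((b / a) i) = f_L(k i / a)`, and the average is itself a Riemann sum for `f_L(k x)`.
-/

/-! ### Sixth-order moments of Gaussian pairs -/

lemma integral_pow_six_gaussianReal (v : NNReal) :
    ∫ x, x ^ 6 ∂(gaussianReal 0 v) = 15 * (v : ℝ) ^ 3 := by
  by_cases hv : v = 0
  · simp [hv]
  have hv' : (0 : ℝ) < v := by positivity
  rw [integral_gaussianReal_eq_integral_smul hv]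
  have h1 : ∀ x : ℝ, gaussianPDFReal 0 v x • x ^ 6 =
      (Real.sqrt (2 * Real.pi * v))⁻¹ *
        (fun y : ℝ => y ^ (6 : ℝ) * Real.exp (-(1 / (2 * v)) * y ^ (2 : ℝ))) |x| := by
    intro x
    have e6 : |x| ^ (6 : ℝ) = x ^ 6 := by
      rw [show (6 : ℝ) = ((6 : ℕ) : ℝ) by norm_num, Real.rpow_natCast]
      exact Even.pow_abs (by decide) x
    have e2 : |x| ^ (2 : ℝ) = x ^ 2 := by
      rw [show (2 : ℝ) = ((2 : ℕ) : ℝ) by norm_num, Real.rpow_natCast]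
      exact Even.pow_abs (by decide) x
    simp only [gaussianPDFReal, e6, e2, smul_eq_mul, sub_zero]
    rw [show -x ^ 2 / (2 * (v : ℝ)) = -(1 / (2 * v)) * x ^ 2 by ring]
    ring
  rw [integral_congr_ae (ae_of_all _ h1), integral_const_mul,
    integral_comp_abs
      (f := fun y : ℝ => y ^ (6 : ℝ) * Real.exp (-(1 / (2 * v)) * y ^ (2 : ℝ))),
    integral_rpow_mul_exp_neg_mul_rpow (by norm_num) (by norm_num) (by positivity)]
  have hG : Real.Gamma (((6 : ℝ) + 1) / 2) = 15 / 8 * Real.sqrt Real.pi := by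
    have := Real.Gamma_nat_add_half 3
    rw [show ((6 : ℝ) + 1) / 2 = ((3 : ℕ) : ℝ) + 1 / 2 by norm_num, this]
    norm_num [Nat.doubleFactorial]
    ring
  have hb : (1 / (2 * (v : ℝ))) ^ (-((6 : ℝ) + 1) / 2) = (2 * v) ^ 3 * Real.sqrt (2 * v) := by
    rw [one_div, Real.inv_rpow (by positivity), ← Real.rpow_neg (by positivity),
      show -(-((6 : ℝ) + 1) / 2) = ((3 : ℕ) : ℝ) + 1 / 2 by norm_num,
      Real.rpow_add (by positivity), Real.rpow_natCast, Real.sqrt_eq_rpow]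
  rw [hG, hb, show 2 * Real.pi * (v : ℝ) = (2 * v) * Real.pi by ring,
    Real.sqrt_mul (by positivity)]
  have : Real.sqrt (2 * v) ≠ 0 := by positivity
  have : Real.sqrt Real.pi ≠ 0 := by positivity
  field_simp
  ring

section

variable {Ω : Type*} [MeasurableSpace Ω] {P : Measure Ω}

/-- The sixth moment of a centered Gaussian variable is `15` times the cube of its variance. -/
lemma ProbabilityTheory.HasGaussianLaw.integral_pow_six {X : Ω → ℝ} (hX : HasGaussianLaw X P)
    (h0 : ∫ ω, X ω ∂P = 0) : ∫ ω, X ω ^ 6 ∂P = 15 * (∫ ω, X ω ^ 2 ∂P) ^ 3 := by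
  have hmap := hX.map_eq_gaussianReal
  have := hX.isProbabilityMeasure
  have hvar : Var[X; P] = ∫ ω, X ω ^ 2 ∂P :=
    variance_of_integral_eq_zero hX.aemeasurable h0
  have h6 : ∫ ω, X ω ^ 6 ∂P = ∫ x, x ^ 6 ∂(P.map X) := by
    rw [integral_map hX.aemeasurable]
    exact (continuous_pow 6).aestronglyMeasurable
  rw [h6, hmap, show ∫ ω, X ω ∂P = 0 from h0, integral_pow_six_gaussianReal, hvar,
    Real.coe_toNNReal _ (integral_nonneg fun ω => sq_nonneg _)]

lemma ProbabilityTheory.HasGaussianLaw.integrable_pow {X : Ω → ℝ} (hX : HasGaussianLaw X P)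
    (n : ℕ) : Integrable (fun ω => X ω ^ n) P := by
  have := hX.isProbabilityMeasure
  have h : MemLp X n P := hX.memLp (by simp)
  refine (integrable_norm_iff (hX.aemeasurable.pow_const n).aestronglyMeasurable).1 ?_
  simpa only [norm_pow] using h.integrable_norm_pow'

lemma ProbabilityTheory.HasGaussianLaw.integrable_pow_mul_pow {X Y : Ω → ℝ}
    (hX : HasGaussianLaw X P) (hY : HasGaussianLaw Y P) (m n : ℕ) :
    Integrable (fun ω => X ω ^ m * Y ω ^ n) P := by
  have := hX.isProbabilityMeasure
  have h1 : MemLp (fun ω => X ω ^ m) 2 P := by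
    rw [memLp_two_iff_integrable_sq (hX.aemeasurable.pow_const m).aestronglyMeasurable]
    simpa only [← pow_mul] using hX.integrable_pow (m * 2)
  have h2 : MemLp (fun ω => Y ω ^ n) 2 P := by
    rw [memLp_two_iff_integrable_sq (hY.aemeasurable.pow_const n).aestronglyMeasurable]
    simpa only [← pow_mul] using hY.integrable_pow (n * 2)
  exact h1.integrable_mul h2

/-- Wick's formula for `E[X³Y³]`, where `(X, Y)` is a centered Gaussian pair. It is the coefficient
of `s³` in `E[(sX + Y)⁶] = 15 E[(sX + Y)²]³`. -/
lemma ProbabilityTheory.HasGaussianLaw.integral_cube_mul_cube {X Y : Ω → ℝ}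
    (hXY : HasGaussianLaw (fun ω => (X ω, Y ω)) P)
    (hX0 : ∫ ω, X ω ∂P = 0) (hY0 : ∫ ω, Y ω ∂P = 0) :
    ∫ ω, X ω ^ 3 * Y ω ^ 3 ∂P = 6 * (∫ ω, X ω * Y ω ∂P) ^ 3 +
      9 * (∫ ω, X ω * Y ω ∂P) * (∫ ω, X ω ^ 2 ∂P) * (∫ ω, Y ω ^ 2 ∂P) := by
  have hX := hXY.fst
  have hY := hXY.snd
  have hint := fun m n => hX.integrable_pow_mul_pow hY m n
  have hprod : ∫ ω, X ω * Y ω ∂P = ∫ ω, X ω ^ 1 * Y ω ^ 1 ∂P := by simp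
  have hXX : ∫ ω, X ω ^ 2 ∂P = ∫ ω, X ω ^ 2 * Y ω ^ 0 ∂P := by simp
  have hYY : ∫ ω, Y ω ^ 2 ∂P = ∫ ω, X ω ^ 0 * Y ω ^ 2 ∂P := by simp
  have key : ∀ s : ℝ,
      (∫ ω, X ω ^ 0 * Y ω ^ 6 ∂P) + 6 * s * (∫ ω, X ω ^ 1 * Y ω ^ 5 ∂P) +
        15 * s ^ 2 * (∫ ω, X ω ^ 2 * Y ω ^ 4 ∂P) + 20 * s ^ 3 * (∫ ω, X ω ^ 3 * Y ω ^ 3 ∂P) +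
        15 * s ^ 4 * (∫ ω, X ω ^ 4 * Y ω ^ 2 ∂P) + 6 * s ^ 5 * (∫ ω, X ω ^ 5 * Y ω ^ 1 ∂P) +
        s ^ 6 * (∫ ω, X ω ^ 6 * Y ω ^ 0 ∂P) =
      15 * (s ^ 2 * (∫ ω, X ω ^ 2 * Y ω ^ 0 ∂P) + 2 * s * (∫ ω, X ω ^ 1 * Y ω ^ 1 ∂P) +
        ∫ ω, X ω ^ 0 * Y ω ^ 2 ∂P) ^ 3 := by
    intro s
    have hZ : HasGaussianLaw (fun ω => s * X ω + Y ω) P :=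
      hXY.map_fun (s • ContinuousLinearMap.fst ℝ ℝ ℝ + ContinuousLinearMap.snd ℝ ℝ ℝ)
    have hZ0 : ∫ ω, (s * X ω + Y ω) ∂P = 0 := by
      rw [integral_add (hX.integrable.const_mul s) hY.integrable, integral_const_mul, hX0, hY0]
      simp
    have h := hZ.integral_pow_six hZ0
    have e2 : ∫ ω, (s * X ω + Y ω) ^ 2 ∂P =
        s ^ 2 * (∫ ω, X ω ^ 2 * Y ω ^ 0 ∂P) + 2 * s * (∫ ω, X ω ^ 1 * Y ω ^ 1 ∂P) +
        ∫ ω, X ω ^ 0 * Y ω ^ 2 ∂P := by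
      simp_rw [← integral_const_mul]
      rw [← integral_add (by fun_prop) (by fun_prop), ← integral_add (by fun_prop) (by fun_prop)]
      congr 1 with ω
      ring
    have e6 : ∫ ω, (s * X ω + Y ω) ^ 6 ∂P =
      (∫ ω, X ω ^ 0 * Y ω ^ 6 ∂P) + 6 * s * (∫ ω, X ω ^ 1 * Y ω ^ 5 ∂P) +
        15 * s ^ 2 * (∫ ω, X ω ^ 2 * Y ω ^ 4 ∂P) + 20 * s ^ 3 * (∫ ω, X ω ^ 3 * Y ω ^ 3 ∂P) +
        15 * s ^ 4 * (∫ ω, X ω ^ 4 * Y ω ^ 2 ∂P) + 6 * s ^ 5 * (∫ ω, X ω ^ 5 * Y ω ^ 1 ∂P) +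
        s ^ 6 * (∫ ω, X ω ^ 6 * Y ω ^ 0 ∂P) := by
      simp_rw [← integral_const_mul]
      rw [← integral_add (by fun_prop) (by fun_prop), ← integral_add (by fun_prop) (by fun_prop),
        ← integral_add (by fun_prop) (by fun_prop), ← integral_add (by fun_prop) (by fun_prop),
        ← integral_add (by fun_prop) (by fun_prop), ← integral_add (by fun_prop) (by fun_prop)]
      congr 1 with ω
      ring
    rw [← e2, ← e6, h]
  rw [hprod, hXX, hYY]
  -- The odd part in `s` is a polynomial with three coefficients: three pairs of values isolate
  -- the one of `s ^ 3`.
  linear_combination (-13 / 960) * (key 1 - key (-1)) + (1 / 120) * (key 2 - key (-2))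
    - (1 / 960) * (key 3 - key (-3))

end

/-! ### The kernel and the function `f_L` -/

/-- The kernel `g_L(u) = Φ(u, u + 1, 0, L)³`, whose sum over the translates `x - m`, `m ∈ ℤ`, is
`f_L(x)`. -/
noncomputable def fbmKernel (L u : ℝ) : ℝ := fbmPhi u (u + 1) 0 L ^ 3

lemma fTerm_eq_fbmKernel (L : ℝ) (m : ℤ) (x : ℝ) : fTerm L m x = fbmKernel L (x - m) := by
  simp only [fTerm, fbmKernel, fbmPhi]
  congr 1
  ring_nf

lemma rpow_third_pow_three {x : ℝ} (hx : 0 ≤ x) : (x ^ (1 / 3 : ℝ)) ^ 3 = x := by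
  rw [← Real.rpow_natCast, ← Real.rpow_mul hx]
  norm_num

lemma continuous_abs_rpow_third : Continuous fun x : ℝ => |x| ^ (1 / 3 : ℝ) :=
  continuous_abs.rpow_const fun _ => Or.inr (by norm_num)

/-- The cubes of the unit increments of `|u|^(1/3)` decay quadratically. -/
lemma abs_rpow_third_increment_cube_le (u : ℝ) :
    |(|u + 1| ^ (1 / 3 : ℝ) - |u| ^ (1 / 3 : ℝ))| ^ 3 ≤ 2 / (1 + u ^ 2) := by
  have hA := rpow_third_pow_three (abs_nonneg (u + 1))
  have hB := rpow_third_pow_three (abs_nonneg u)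
  have hA0 : 0 ≤ |u + 1| ^ (1 / 3 : ℝ) := by positivity
  have hB0 : 0 ≤ |u| ^ (1 / 3 : ℝ) := by positivity
  generalize |u + 1| ^ (1 / 3 : ℝ) = A at *
  generalize |u| ^ (1 / 3 : ℝ) = B at *
  have hAB : |A - B| * (A ^ 2 + A * B + B ^ 2) ≤ 1 := by
    rw [← abs_of_nonneg (show 0 ≤ A ^ 2 + A * B + B ^ 2 by positivity), ← abs_mul,
      show (A - B) * (A ^ 2 + A * B + B ^ 2) = A ^ 3 - B ^ 3 by ring, hA, hB]
    simpa using abs_abs_sub_abs_le_abs_sub (u + 1) u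
  have hd := abs_nonneg (A - B)
  have h1 : |A - B| ^ 3 ≤ 1 := by
    calc |A - B| ^ 3 = |A - B| * (A - B) ^ 2 := by rw [← sq_abs (A - B)]; ring
      _ ≤ |A - B| * (A ^ 2 + A * B + B ^ 2) := by gcongr; nlinarith
      _ ≤ 1 := hAB
  have h2 : |A - B| ^ 3 * u ^ 2 ≤ 1 := by
    calc |A - B| ^ 3 * u ^ 2 = (|A - B| * B ^ 2) ^ 3 := by rw [← sq_abs u, ← hB]; ring
      _ ≤ (|A - B| * (A ^ 2 + A * B + B ^ 2)) ^ 3 := by gcongr; nlinarith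
      _ ≤ 1 := pow_le_one₀ (by positivity) hAB
  rw [le_div_iff₀ (by positivity)]
  linarith

lemma abs_fbmKernel_le (L u : ℝ) : |fbmKernel L u| ≤ (24 + 16 * L ^ 2) / (1 + u ^ 2) := by
  have h1 := abs_rpow_third_increment_cube_le u
  have h2 := abs_rpow_third_increment_cube_le (u - L)
  have e : fbmPhi u (u + 1) 0 L = (|u + 1| ^ (1 / 3 : ℝ) - |u| ^ (1 / 3 : ℝ)) -
      (|u - L + 1| ^ (1 / 3 : ℝ) - |u - L| ^ (1 / 3 : ℝ)) := by
    simp only [fbmPhi, sub_zero]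
    rw [show u + 1 - L = u - L + 1 by ring]
    ring
  have hshift : 2 / (1 + (u - L) ^ 2) ≤ 2 * (2 * (1 + L ^ 2)) / (1 + u ^ 2) := by
    rw [div_le_div_iff₀ (by positivity) (by positivity)]
    nlinarith [sq_nonneg (u - 2 * L), sq_nonneg (L * (u - L))]
  rw [fbmKernel, e, abs_pow]
  generalize |u + 1| ^ (1 / 3 : ℝ) - |u| ^ (1 / 3 : ℝ) = p at *
  generalize |u - L + 1| ^ (1 / 3 : ℝ) - |u - L| ^ (1 / 3 : ℝ) = q at *
  have hp := abs_nonneg p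
  have hq := abs_nonneg q
  calc |p - q| ^ 3 ≤ (|p| + |q|) ^ 3 := by gcongr; exact abs_sub p q
    _ ≤ 4 * (|p| ^ 3 + |q| ^ 3) := by
      nlinarith [mul_nonneg (add_nonneg hp hq) (sq_nonneg (|p| - |q|))]
    _ ≤ 4 * (2 / (1 + u ^ 2) + 2 * (2 * (1 + L ^ 2)) / (1 + u ^ 2)) := by linarith
    _ = (24 + 16 * L ^ 2) / (1 + u ^ 2) := by ring

lemma summable_int_one_div_one_add_sq : Summable fun m : ℤ => 1 / (1 + (m : ℝ) ^ 2) := by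
  refine Summable.of_norm_bounded_eventually
    ((Real.summable_one_div_int_pow (p := 2)).2 (by norm_num)) ?_
  filter_upwards [(Set.finite_singleton (0 : ℤ)).compl_mem_cofinite] with m hm
  have hm' : (m : ℝ) ≠ 0 := by exact_mod_cast hm
  rw [Real.norm_of_nonneg (by positivity)]
  gcongr
  linarith

lemma one_div_one_add_sub_sq_le (x y : ℝ) :
    1 / (1 + (x - y) ^ 2) ≤ 2 * (1 + x ^ 2) * (1 / (1 + y ^ 2)) := by
  rw [mul_one_div, div_le_div_iff₀ (by positivity) (by positivity)]
  nlinarith [sq_nonneg (y - 2 * x), sq_nonneg (x * (x - y))]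

lemma abs_fTerm_le {R L x : ℝ} (hL : |L| ≤ R) (hx : |x| ≤ R) (m : ℤ) :
    |fTerm L m x| ≤ (24 + 16 * R ^ 2) * (2 * (1 + R ^ 2)) * (1 / (1 + (m : ℝ) ^ 2)) := by
  have hL2 : L ^ 2 ≤ R ^ 2 := sq_le_sq' (by linarith [neg_abs_le L]) ((le_abs_self L).trans hL)
  have hx2 : x ^ 2 ≤ R ^ 2 := sq_le_sq' (by linarith [neg_abs_le x]) ((le_abs_self x).trans hx)
  rw [fTerm_eq_fbmKernel]
  calc |fbmKernel L (x - m)| ≤ (24 + 16 * L ^ 2) * (1 / (1 + (x - m) ^ 2)) := by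
        rw [mul_one_div]; exact abs_fbmKernel_le L _
    _ ≤ (24 + 16 * R ^ 2) * (2 * (1 + R ^ 2) * (1 / (1 + (m : ℝ) ^ 2))) := by
        gcongr
        exact (one_div_one_add_sub_sq_le x m).trans (by gcongr)
    _ = _ := by ring

lemma summable_fTerm (L x : ℝ) : Summable fun m : ℤ => fTerm L m x :=
  Summable.of_norm_bounded (summable_int_one_div_one_add_sq.mul_left _)
    (fun m => abs_fTerm_le (le_max_left |L| |x|) (le_max_right |L| |x|) m)

lemma continuous_fTerm (m : ℤ) : Continuous fun z : ℝ × ℝ => fTerm z.1 m z.2 := by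
  have h := continuous_abs_rpow_third
  unfold fTerm fbmPhi
  refine Continuous.pow (((Continuous.add ?_ ?_).sub ?_).sub ?_) 3
  all_goals exact h.comp (by fun_prop)

/-- `f_L(x)` is jointly continuous in `(L, x)`, on the whole plane. -/
lemma continuous_fSum : Continuous fun z : ℝ × ℝ => fSum z.1 z.2 := by
  refine continuous_iff_continuousAt.2 fun z₀ => ?_
  have h : ContinuousOn (fun z : ℝ × ℝ => fSum z.1 z.2) (Metric.ball 0 (‖z₀‖ + 1)) := by
    refine continuousOn_tsum (fun m => (continuous_fTerm m).continuousOn)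
      (summable_int_one_div_one_add_sq.mul_left
        ((24 + 16 * (‖z₀‖ + 1) ^ 2) * (2 * (1 + (‖z₀‖ + 1) ^ 2)))) fun m z hz => ?_
    have hz' : ‖z‖ ≤ ‖z₀‖ + 1 := (mem_ball_zero_iff.1 hz).le
    exact abs_fTerm_le ((norm_fst_le z).trans hz') ((norm_snd_le z).trans hz') m
  exact h.continuousAt (Metric.isOpen_ball.mem_nhds (by simp))

lemma continuous_fSum_right (L : ℝ) : Continuous (fSum L) := by
  have h : Continuous fun x : ℝ => (L, x) := by fun_prop
  simpa only [Function.comp_def] using continuous_fSum.comp h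

lemma fSum_add_intCast (L x : ℝ) (k : ℤ) : fSum L (x + k) = fSum L x := by
  unfold fSum
  rw [← (Equiv.addRight k).tsum_eq]
  refine tsum_congr fun m => ?_
  rw [fTerm_eq_fbmKernel, fTerm_eq_fbmKernel]
  congr 1
  simp

lemma fHat_eq_fSum (L x : ℝ) : fHat L x = fSum L x := by
  have := fSum_add_intCast L (x - ⌊x⌋) ⌊x⌋
  rw [fHat, ← this, sub_add_cancel]

/-- The symmetry of `f_L` under `x ↦ L - x`, inherited from `g_L(L - 1 - u) = g_L(u)`. -/
lemma fSum_sub_left (L x : ℝ) : fSum L (L - x) = fSum L x := by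
  unfold fSum
  rw [← (Equiv.subLeft (1 : ℤ)).tsum_eq]
  refine tsum_congr fun m => ?_
  simp only [fTerm, fbmPhi, Equiv.subLeft_apply, Int.cast_sub, Int.cast_one]
  rw [show L - x + 1 - (1 - m) = -(x - (m + L)) by ring,
    show L - x - (1 - m + L) = -(x + 1 - m) by ring,
    show L - x - (1 - m) = -(x + 1 - (m + L)) by ring,
    show L - x + 1 - (1 - m + L) = -(x - m) by ring]
  simp only [abs_neg]
  ring

lemma summable_fbmKernel_sub (L y : ℝ) : Summable fun m : ℤ => fbmKernel L (m - y) := by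
  rw [← (Equiv.neg ℤ).summable_iff]
  refine (summable_fTerm L (-y)).congr fun m => ?_
  rw [fTerm_eq_fbmKernel, Function.comp_apply, Equiv.neg_apply]
  congr 1
  push_cast
  ring

/-- The series for `f_L(-y) = f_L(L + y)`, indexed so that its terms over `0 ≤ m < J` are the
rescaled cubed covariances with a fixed increment that occur in `E[W_a W_b]`. -/
lemma tsum_fbmKernel_sub (L y : ℝ) : ∑' m : ℤ, fbmKernel L (m - y) = fSum L (L + y) := by
  have h := fSum_sub_left L (-y)
  rw [sub_neg_eq_add] at h
  rw [h, fSum, ← (Equiv.neg ℤ).tsum_eq]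
  refine tsum_congr fun m => ?_
  rw [fTerm_eq_fbmKernel, Equiv.neg_apply]
  congr 1
  push_cast
  ring

/-- `f_{ℓ n}` converges to `f_L` uniformly on the whole line when `ℓ n → L`. -/
lemma eventually_abs_fSum_sub_lt {ℓ : ℕ → ℝ} {L : ℝ} (h : Tendsto ℓ atTop (𝓝 L)) {ε : ℝ}
    (hε : 0 < ε) : ∀ᶠ n in atTop, ∀ x, |fSum (ℓ n) x - fSum L x| < ε := by
  have huc : UniformContinuousOn (fun z : ℝ × ℝ => fSum z.1 z.2)
      (Metric.closedBall L 1 ×ˢ Set.Icc 0 1) :=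
    ((isCompact_closedBall L 1).prod isCompact_Icc).uniformContinuousOn_of_continuous
      continuous_fSum.continuousOn
  obtain ⟨δ, hδ, H⟩ := Metric.uniformContinuousOn_iff.1 huc ε hε
  filter_upwards [Metric.tendsto_nhds.1 h (min δ 1) (lt_min hδ one_pos)] with n hn x
  have hfr : Int.fract x ∈ Set.Icc (0 : ℝ) 1 := ⟨Int.fract_nonneg x, (Int.fract_lt_one x).le⟩
  have hper : ∀ L, fSum L x = fSum L (Int.fract x) := fun L => (fHat_eq_fSum L x).symm
  rw [hper, hper]
  refine H (ℓ n, Int.fract x) ⟨?_, hfr⟩ (L, Int.fract x) ⟨?_, hfr⟩ ?_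
  · exact Metric.mem_closedBall.2 (hn.le.trans (min_le_right _ _))
  · simp
  · simpa [Prod.dist_eq, hδ] using hn.trans_le (min_le_left _ _)

lemma exists_abs_fSum_le (L : ℝ) : ∃ M, ∀ x, |fSum L x| ≤ M := by
  obtain ⟨M, hM⟩ := isCompact_Icc.exists_bound_of_continuousOn
    (continuous_fSum_right L).continuousOn (s := Set.Icc 0 1)
  refine ⟨M, fun x => ?_⟩
  rw [← fHat_eq_fSum]
  exact hM _ ⟨Int.fract_nonneg x, (Int.fract_lt_one x).le⟩

/-! ### Tails of the series for `f_L` -/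

lemma sum_range_one_div_one_add_sq_le {y : ℝ} (hy : 0 ≤ y) (n : ℕ) :
    ∑ k ∈ Finset.range n, 1 / (1 + ((k : ℝ) + y) ^ 2) ≤
      4 / (2 * y + 1) - 4 / (2 * (n + y) + 1) := by
  induction n with
  | zero => simp
  | succ n ih =>
    rw [Finset.sum_range_succ]
    have h0 : 0 ≤ (n : ℝ) + y := by positivity
    have : 1 / (1 + ((n : ℝ) + y) ^ 2) ≤
        4 / (2 * (n + y) + 1) - 4 / (2 * ((n + 1 : ℕ) + y) + 1) := by
      push_cast
      rw [show (n : ℝ) + 1 + y = n + y + 1 by ring]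
      generalize (n : ℝ) + y = z at *
      rw [div_sub_div _ _ (by positivity) (by positivity),
        div_le_div_iff₀ (by positivity) (by positivity)]
      nlinarith [sq_nonneg (z - 1)]
    linarith

lemma summable_one_div_one_add_sq {y : ℝ} (hy : 0 ≤ y) :
    Summable fun k : ℕ => 1 / (1 + ((k : ℝ) + y) ^ 2) := by
  refine summable_of_sum_range_le (c := 4 / (2 * y + 1)) (fun k => by positivity) fun n => ?_
  have : (0 : ℝ) ≤ 4 / (2 * (n + y) + 1) := by positivity
  linarith [sum_range_one_div_one_add_sq_le hy n]

lemma tsum_one_div_one_add_sq_le {y : ℝ} (hy : 0 ≤ y) :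
    ∑' k : ℕ, 1 / (1 + ((k : ℝ) + y) ^ 2) ≤ 4 / (2 * y + 1) := by
  refine Real.tsum_le_of_sum_range_le (fun k => by positivity) fun n => ?_
  have : (0 : ℝ) ≤ 4 / (2 * (n + y) + 1) := by positivity
  linarith [sum_range_one_div_one_add_sq_le hy n]

lemma abs_tsum_le_of_decay {f : ℕ → ℝ} {K y : ℝ} (hK : 0 ≤ K) (hy : 0 ≤ y)
    (hf : ∀ k : ℕ, |f k| ≤ K * (1 / (1 + ((k : ℝ) + y) ^ 2))) :
    |∑' k, f k| ≤ K * (4 / (2 * y + 1)) :=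
  (tsum_of_norm_bounded (f := f) ((summable_one_div_one_add_sq hy).hasSum.mul_left K) hf).trans
    (mul_le_mul_of_nonneg_left (tsum_one_div_one_add_sq_le hy) hK)

/-- The error made when the series over `ℤ` for `f_L(L + y)` is replaced by its terms with index in
`[0, J)`, in terms of the distances `y` and `w` (up to `1`) to the two ends of this range. -/
lemma abs_sum_fbmKernel_sub_fSum_le {L K y w : ℝ} (hK : 0 ≤ K)
    (hg : ∀ u, |fbmKernel L u| ≤ K * (1 / (1 + u ^ 2))) (hy : 0 ≤ y) (hw : 0 ≤ w) {J : ℕ}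
    (hJ : w - 1 ≤ J - y) :
    |∑ j ∈ Finset.range J, fbmKernel L (j - y) - fSum L (L + y)| ≤
      K * (4 / (2 * y + 1)) + 3 * K * (4 / (2 * w + 1)) := by
  have hs := summable_fbmKernel_sub L y
  have hs1 : Summable fun k : ℕ => fbmKernel L ((k : ℤ) - y) :=
    hs.comp_injective Nat.cast_injective
  have hs2 : Summable fun k : ℕ => fbmKernel L ((-((k : ℤ) + 1) : ℤ) - y) :=
    hs.comp_injective (i := fun k : ℕ => -((k : ℤ) + 1)) fun x z hxz => by simpa using hxz
  have hsplit := tsum_of_nat_of_neg_add_one (f := fun m : ℤ => fbmKernel L (m - y)) hs1 hs2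
  rw [tsum_fbmKernel_sub, ← hs1.sum_add_tsum_nat_add J] at hsplit
  simp only [Int.cast_natCast] at hsplit
  have h1 : |∑' k : ℕ, fbmKernel L ((-((k : ℤ) + 1) : ℤ) - y)| ≤ K * (4 / (2 * y + 1)) := by
    refine abs_tsum_le_of_decay hK hy fun k => (hg _).trans ?_
    gcongr K * (1 / (1 + ?_))
    push_cast
    nlinarith [(Nat.cast_nonneg k : (0 : ℝ) ≤ k)]
  have h2 : |∑' k : ℕ, fbmKernel L (((k + J : ℕ) : ℝ) - y)| ≤ 3 * K * (4 / (2 * w + 1)) := by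
    refine abs_tsum_le_of_decay (by positivity) hw fun k => (hg _).trans ?_
    rw [mul_comm 3 K, mul_assoc]
    gcongr
    have hz : (k : ℝ) + w ≤ ((k + J : ℕ) : ℝ) - y + 1 := by push_cast; linarith
    have hk : 0 ≤ (k : ℝ) + w := by positivity
    -- The arguments may start as low as `w - 1`; the factor `3` pays for the shift by `1`, as
    -- `1 + (z + 1) ^ 2 ≤ 3 * (1 + z ^ 2)`.
    rw [mul_one_div, div_le_div_iff₀ (by positivity) (by positivity)]
    generalize ((k + J : ℕ) : ℝ) - y = z at *
    nlinarith [sq_nonneg (z - 1 / 2)]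
  rw [hsplit]
  calc _ = |∑' k : ℕ, fbmKernel L ((-((k : ℤ) + 1) : ℤ) - y) +
        ∑' k : ℕ, fbmKernel L (((k + J : ℕ) : ℝ) - y)| := by
        rw [← abs_neg]; congr 1; ring
    _ ≤ _ := (abs_add_le _ _).trans (add_le_add h1 h2)

lemma abs_sum_sum_fbmKernel_sub_le {L K l : ℝ} (hK : 0 ≤ K)
    (hg : ∀ u, |fbmKernel L u| ≤ K * (1 / (1 + u ^ 2))) (hl : 0 < l) (hlL : l ≤ L) {N J : ℕ}
    (hNJ : L * N ≤ J + 1) :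
    |∑ i ∈ Finset.range N, ∑ j ∈ Finset.range J, fbmKernel L (j - L * i) -
        ∑ i ∈ Finset.range N, fSum L (L * (i + 1))| ≤
      4 * K * ∑ i ∈ Finset.range N, 4 / (2 * (l * i) + 1) := by
  have hrow : ∀ i ∈ Finset.range N,
      |∑ j ∈ Finset.range J, fbmKernel L (j - L * i) - fSum L (L * (i + 1))| ≤
        K * (4 / (2 * (l * i) + 1)) + 3 * K * (4 / (2 * (l * ((N - 1 - i : ℕ) : ℝ)) + 1)) := by
    intro i hi
    have hiN : i + 1 ≤ N := Finset.mem_range.1 hi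
    have hL : 0 < L := hl.trans_le hlL
    rw [show L * ((i : ℝ) + 1) = L + L * i by ring]
    refine (abs_sum_fbmKernel_sub_fSum_le hK hg (by positivity)
      (w := l * ((N - 1 - i : ℕ) : ℝ)) (by positivity) ?_).trans ?_
    · rw [Nat.sub_sub, Nat.cast_sub (by omega)]
      push_cast
      have : (i : ℝ) + 1 ≤ N := by exact_mod_cast hiN
      nlinarith
    · gcongr
  rw [← Finset.sum_sub_distrib]
  refine (Finset.abs_sum_le_sum_abs _ _).trans ((Finset.sum_le_sum hrow).trans_eq ?_)
  rw [Finset.sum_add_distrib, ← Finset.mul_sum, ← Finset.mul_sum,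
    Finset.sum_range_reflect (fun i : ℕ => 4 / (2 * (l * (i : ℝ)) + 1)) N]
  ring

/-! ### Moments of the increments and of the cubic variations -/

lemma cubicVar_eq_sum_range {Ω : Type*} (B : ℝ → Ω → ℝ) (n : ℕ) (t : ℝ) (ω : Ω) :
    cubicVar B n t ω = ∑ j ∈ Finset.range ⌊(n : ℝ) * t⌋₊,
      (B (((j : ℝ) + 1) / n) ω - B ((j : ℝ) / n) ω) ^ 3 := by
  have h := Finset.sum_Ico_add' (fun j : ℕ =>
    (B ((j : ℝ) / (n : ℝ)) ω - B (((j : ℝ) - 1) / (n : ℝ)) ω) ^ 3) 0 ⌊(n : ℝ) * t⌋₊ 1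
  rw [cubicVar, ← Finset.Ico_add_one_right_eq_Icc, Finset.range_eq_Ico, ← h]
  simp

lemma cubicVar_mul_eq {Ω : Type*} (B : ℝ → Ω → ℝ) (m n : ℕ) (t : ℝ) (ω : Ω) :
    cubicVar B m t ω * cubicVar B n t ω =
      ∑ i ∈ Finset.range ⌊(m : ℝ) * t⌋₊, ∑ j ∈ Finset.range ⌊(n : ℝ) * t⌋₊,
        (B (((i : ℝ) + 1) / m) ω - B ((i : ℝ) / m) ω) ^ 3 *
          (B (((j : ℝ) + 1) / n) ω - B ((j : ℝ) / n) ω) ^ 3 := by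
  rw [cubicVar_eq_sum_range, cubicVar_eq_sum_range, Finset.sum_mul_sum]

section

variable {Ω : Type*} [MeasurableSpace Ω] {P : Measure Ω} {B : ℝ → Ω → ℝ}

lemma IsFBMSixth.hasGaussianLaw_increment (hB : IsFBMSixth P B) (s t : ℝ) :
    HasGaussianLaw (fun ω => B t ω - B s ω) P :=
  hB.gaussian.hasGaussianLaw_fun_sub

lemma IsFBMSixth.hasGaussianLaw_increments (hB : IsFBMSixth P B) (s t u v : ℝ) :
    HasGaussianLaw (fun ω => (B t ω - B s ω, B v ω - B u ω)) P := by
  have h : HasGaussianLaw (fun ω => fun i : Fin 4 => B (![s, t, u, v] i) ω) P := by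
    classical
    have h1 := (hB.gaussian.comp_right ![s, t, u, v]).hasGaussianLaw Finset.univ
    exact h1.map_fun (ContinuousLinearMap.pi fun i : Fin 4 =>
      ContinuousLinearMap.proj (⟨i, Finset.mem_univ i⟩ : (Finset.univ : Finset (Fin 4))))
  let p : Fin 4 → (Fin 4 → ℝ) →L[ℝ] ℝ := fun i => ContinuousLinearMap.proj i
  let M : (Fin 4 → ℝ) →L[ℝ] ℝ × ℝ := (p 1 - p 0).prod (p 3 - p 2)
  exact h.map_fun M

lemma IsFBMSixth.integral_increment (hB : IsFBMSixth P B) (s t : ℝ) :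
    ∫ ω, (B t ω - B s ω) ∂P = 0 := by
  rw [integral_sub (hB.gaussian.hasGaussianLaw_eval t).integrable
    (hB.gaussian.hasGaussianLaw_eval s).integrable, hB.centered, hB.centered, sub_zero]

lemma IsFBMSixth.integral_increment_mul (hB : IsFBMSixth P B) (s t u v : ℝ) :
    ∫ ω, (B t ω - B s ω) * (B v ω - B u ω) ∂P = fbmPhi s t u v / 2 := by
  have hi : ∀ s t, Integrable (fun ω => B s ω * B t ω) P := fun s t => by
    simpa using (hB.gaussian.hasGaussianLaw_eval s).integrable_pow_mul_pow
      (hB.gaussian.hasGaussianLaw_eval t) 1 1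
  have e : ∀ ω, (B t ω - B s ω) * (B v ω - B u ω) =
      (B t ω * B v ω - B t ω * B u ω) - (B s ω * B v ω - B s ω * B u ω) := fun ω => by ring
  simp_rw [e]
  have hi' : ∀ s t u v, Integrable (fun ω => B s ω * B t ω - B u ω * B v ω) P :=
    fun s t u v => (hi s t).sub (hi u v)
  rw [integral_sub (hi' _ _ _ _) (hi' _ _ _ _), integral_sub (hi _ _) (hi _ _),
    integral_sub (hi _ _) (hi _ _)]
  simp only [hB.covariance, fbmPhi]
  rw [abs_sub_comm v t, abs_sub_comm u t, abs_sub_comm v s, abs_sub_comm u s]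
  ring

lemma IsFBMSixth.integral_increment_sq (hB : IsFBMSixth P B) (s t : ℝ) :
    ∫ ω, (B t ω - B s ω) ^ 2 ∂P = |t - s| ^ (1 / 3 : ℝ) := by
  simp_rw [sq]
  rw [hB.integral_increment_mul, fbmPhi, abs_sub_comm s t, sub_self, sub_self, abs_zero,
    Real.zero_rpow (by norm_num)]
  ring

lemma IsFBMSixth.integrable_cube_mul_cube (hB : IsFBMSixth P B) (s t u v : ℝ) :
    Integrable (fun ω => (B t ω - B s ω) ^ 3 * (B v ω - B u ω) ^ 3) P :=
  (hB.hasGaussianLaw_increment s t).integrable_pow_mul_pow (hB.hasGaussianLaw_increment u v) 3 3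

lemma IsFBMSixth.integrable_cubicVar_mul (hB : IsFBMSixth P B) (m n : ℕ) (t : ℝ) :
    Integrable (fun ω => cubicVar B m t ω * cubicVar B n t ω) P := by
  simp_rw [cubicVar_mul_eq]
  exact integrable_finsetSum _ fun i _ => integrable_finsetSum _ fun j _ =>
    hB.integrable_cube_mul_cube _ _ _ _

lemma IsFBMSixth.integral_cube_mul_cube (hB : IsFBMSixth P B) (s t u v : ℝ) :
    ∫ ω, (B t ω - B s ω) ^ 3 * (B v ω - B u ω) ^ 3 ∂P =
      3 / 4 * fbmPhi s t u v ^ 3 +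
        9 / 2 * (|t - s| ^ (1 / 3 : ℝ) * |v - u| ^ (1 / 3 : ℝ)) * fbmPhi s t u v := by
  rw [(hB.hasGaussianLaw_increments s t u v).integral_cube_mul_cube
    (hB.integral_increment s t) (hB.integral_increment u v), hB.integral_increment_mul,
    hB.integral_increment_sq, hB.integral_increment_sq]
  ring

/-- The scaling relation that brings the covariance of two increments to the kernel `g_L`, with `L`
the ratio of the two mesh sizes. -/
lemma fbmPhi_pow_three_eq {a b : ℝ} (ha : 0 < a) (hb : 0 < b) (i j : ℝ) :
    fbmPhi (i / a) ((i + 1) / a) (j / b) ((j + 1) / b) ^ 3 =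
      1 / b * fbmKernel (b / a) (j - b / a * i) := by
  have h : ∀ x : ℝ, |x| ^ (1 / 3 : ℝ) = (1 / b) ^ (1 / 3 : ℝ) * |b * x| ^ (1 / 3 : ℝ) := by
    intro x
    rw [← Real.mul_rpow (by positivity) (by positivity), abs_mul, abs_of_pos hb, ← mul_assoc,
      one_div_mul_cancel hb.ne', one_mul]
  have e : fbmPhi (i / a) ((i + 1) / a) (j / b) ((j + 1) / b) = (1 / b) ^ (1 / 3 : ℝ) *
      fbmPhi (j - b / a * i) (j - b / a * i + 1) 0 (b / a) := by
    unfold fbmPhi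
    rw [h ((i + 1) / a - j / b), h (i / a - (j + 1) / b), h (i / a - j / b),
      h ((i + 1) / a - (j + 1) / b),
      show b * ((i + 1) / a - j / b) = -(j - b / a * i - b / a) by field_simp; ring,
      show b * (i / a - (j + 1) / b) = -(j - b / a * i + 1 - 0) by field_simp; ring,
      show b * (i / a - j / b) = -(j - b / a * i - 0) by field_simp; ring,
      show b * ((i + 1) / a - (j + 1) / b) = -(j - b / a * i + 1 - b / a) by field_simp; ring]
    simp only [abs_neg]
    ring
  rw [e, mul_pow, rpow_third_pow_three (by positivity), fbmKernel]

/-- Summing the covariances of the increments over two partitions telescopes. -/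
lemma sum_sum_fbmPhi (x y : ℕ → ℝ) (N J : ℕ) :
    ∑ i ∈ Finset.range N, ∑ j ∈ Finset.range J, fbmPhi (x i) (x (i + 1)) (y j) (y (j + 1)) =
      fbmPhi (x 0) (x N) (y 0) (y J) := by
  let ψ : ℝ → ℝ → ℝ := fun s u => |s - u| ^ (1 / 3 : ℝ)
  have h1 : ∀ i, ∑ j ∈ Finset.range J, fbmPhi (x i) (x (i + 1)) (y j) (y (j + 1)) =
      (ψ (x (i + 1)) (y 0) - ψ (x (i + 1)) (y J)) - (ψ (x i) (y 0) - ψ (x i) (y J)) := by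
    intro i
    have := Finset.sum_range_sub (fun j => ψ (x i) (y j) - ψ (x (i + 1)) (y j)) J
    rw [show (ψ (x (i + 1)) (y 0) - ψ (x (i + 1)) (y J)) - (ψ (x i) (y 0) - ψ (x i) (y J)) =
      ψ (x i) (y J) - ψ (x (i + 1)) (y J) - (ψ (x i) (y 0) - ψ (x (i + 1)) (y 0)) by ring, ← this]
    refine Finset.sum_congr rfl fun j _ => ?_
    simp only [fbmPhi, ψ]
    ring
  simp_rw [h1]
  rw [Finset.sum_range_sub (fun i => ψ (x i) (y 0) - ψ (x i) (y J))]
  simp only [fbmPhi, ψ]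
  ring

lemma IsFBMSixth.integral_cubicVar_mul (hB : IsFBMSixth P B) {m n : ℕ} (hm : 0 < m) (hn : 0 < n)
    (t : ℝ) :
    ∫ ω, cubicVar B m t ω * cubicVar B n t ω ∂P =
      3 / 4 * (1 / n * ∑ i ∈ Finset.range ⌊(m : ℝ) * t⌋₊, ∑ j ∈ Finset.range ⌊(n : ℝ) * t⌋₊,
        fbmKernel ((n : ℝ) / m) (j - (n : ℝ) / m * i)) +
      9 / 2 * ((1 / (m : ℝ)) ^ (1 / 3 : ℝ) * (1 / (n : ℝ)) ^ (1 / 3 : ℝ)) *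
        fbmPhi 0 (⌊(m : ℝ) * t⌋₊ / m) 0 (⌊(n : ℝ) * t⌋₊ / n) := by
  have hm' : (0 : ℝ) < m := by exact_mod_cast hm
  have hn' : (0 : ℝ) < n := by exact_mod_cast hn
  have hΦ := sum_sum_fbmPhi (fun i : ℕ => (i : ℝ) / m) (fun j : ℕ => (j : ℝ) / n)
    ⌊(m : ℝ) * t⌋₊ ⌊(n : ℝ) * t⌋₊
  simp only [Nat.cast_zero, zero_div, Nat.cast_add, Nat.cast_one] at hΦ
  simp_rw [cubicVar_mul_eq]
  rw [integral_finsetSum _ fun i _ => integrable_finsetSum _ fun j _ =>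
    hB.integrable_cube_mul_cube _ _ _ _, ← hΦ]
  simp_rw [Finset.mul_sum]
  rw [← Finset.sum_add_distrib]
  refine Finset.sum_congr rfl fun i _ => ?_
  rw [integral_finsetSum _ fun j _ => hB.integrable_cube_mul_cube _ _ _ _,
    ← Finset.sum_add_distrib]
  refine Finset.sum_congr rfl fun j _ => ?_
  rw [hB.integral_cube_mul_cube, fbmPhi_pow_three_eq hm' hn',
    show ((i : ℝ) + 1) / m - i / m = 1 / m by ring, show ((j : ℝ) + 1) / n - j / n = 1 / n by ring,
    abs_of_pos (by positivity), abs_of_pos (by positivity)]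

end

/-! ### Riemann sums and averages over fractions -/

/-- Right Riemann sums of a continuous function with mesh `1 / a n → 0`. -/
lemma tendsto_riemann_sum {h : ℝ → ℝ} (hh : Continuous h) {a : ℕ → ℕ}
    (ha : Tendsto a atTop atTop) {t : ℝ} (ht : 0 ≤ t) :
    Tendsto (fun n => 1 / (a n : ℝ) * ∑ i ∈ Finset.range ⌊(a n : ℝ) * t⌋₊, h ((i + 1) / a n))
      atTop (𝓝 (∫ x in (0 : ℝ)..t, h x)) := by
  have ha' : Tendsto (fun n => (a n : ℝ)) atTop atTop := tendsto_natCast_atTop_atTop.comp ha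
  have hN : Tendsto (fun n => (⌊(a n : ℝ) * t⌋₊ : ℝ) / a n) atTop (𝓝 t) := by
    have := (tendsto_nat_floor_mul_div_atTop ht).comp ha'
    simpa only [Function.comp_def, mul_comm t] using this
  have hprim : Tendsto (fun n => ∫ x in (0 : ℝ)..((⌊(a n : ℝ) * t⌋₊ : ℝ) / a n), h x) atTop
      (𝓝 (∫ x in (0 : ℝ)..t, h x)) :=
    ((intervalIntegral.continuous_primitive (fun _ _ => hh.intervalIntegrable _ _) 0).tendsto
      t).comp hN
  refine tendsto_of_tendsto_of_dist hprim ?_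
  rw [Metric.tendsto_nhds]
  intro ε hε
  obtain ⟨δ, hδ, H⟩ := Metric.uniformContinuousOn_iff.1
    ((isCompact_Icc (a := 0) (b := t)).uniformContinuousOn_of_continuous hh.continuousOn)
    (ε / (t + 1)) (by positivity)
  filter_upwards [ha'.eventually_gt_atTop (1 / δ), ha'.eventually_gt_atTop 0] with n hn hn0
  generalize (a n : ℝ) = A at *
  set N := ⌊A * t⌋₊ with hNdef
  have hNt : (N : ℝ) / A ≤ t := by
    rw [div_le_iff₀ hn0, mul_comm]
    exact Nat.floor_le (by positivity)
  have hsum := intervalIntegral.sum_integral_adjacent_intervals (μ := volume) (f := h)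
    (a := fun i : ℕ => (i : ℝ) / A) (n := N) fun k _ => hh.intervalIntegrable _ _
  simp only [Nat.cast_zero, zero_div, Nat.cast_add, Nat.cast_one] at hsum
  have hterm : ∀ i ∈ Finset.range N,
      |(∫ x in ((i : ℝ) / A)..(((i : ℝ) + 1) / A), h x) - 1 / A * h ((i + 1) / A)| ≤
        ε / (t + 1) * (1 / A) := by
    intro i hi
    have hiN : (i : ℝ) + 1 ≤ N := by exact_mod_cast Finset.mem_range.1 hi
    have hlen : ((i : ℝ) + 1) / A - i / A = 1 / A := by ring
    have hle : (i : ℝ) / A ≤ ((i : ℝ) + 1) / A := by gcongr; linarith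
    have hright : ((i : ℝ) + 1) / A ≤ t := le_trans (by gcongr) hNt
    have hconst : 1 / A * h ((i + 1) / A) =
        ∫ x in ((i : ℝ) / A)..(((i : ℝ) + 1) / A), h ((i + 1) / A) := by
      rw [intervalIntegral.integral_const, hlen, smul_eq_mul]
    rw [hconst, ← intervalIntegral.integral_sub (hh.intervalIntegrable _ _)
      (by simp)]
    have := intervalIntegral.norm_integral_le_of_norm_le_const (a := (i : ℝ) / A)
      (b := ((i : ℝ) + 1) / A) (C := ε / (t + 1)) (f := fun x => h x - h ((i + 1) / A)) ?_
    · rwa [hlen, abs_of_pos (by positivity)] at this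
    · intro x hx
      rw [Set.uIoc_of_le hle] at hx
      have h0 : 0 ≤ (i : ℝ) / A := by positivity
      refine (H x ⟨h0.trans hx.1.le, hx.2.trans hright⟩ _ ⟨h0.trans hle, hright⟩ ?_).le
      rw [Real.dist_eq, abs_sub_comm, abs_of_nonneg (by linarith [hx.2])]
      have : 1 / A < δ := (one_div_lt hδ hn0).1 hn
      linarith [hx.1]
  rw [dist_zero_right, Real.dist_eq, Real.norm_eq_abs, abs_abs, ← hsum, Finset.mul_sum,
    ← Finset.sum_sub_distrib]
  calc _ ≤ ∑ i ∈ Finset.range N, ε / (t + 1) * (1 / A) :=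
        (Finset.abs_sum_le_sum_abs _ _).trans (Finset.sum_le_sum hterm)
    _ = ε / (t + 1) * (N / A) := by rw [Finset.sum_const, Finset.card_range, nsmul_eq_mul]; ring
    _ ≤ ε / (t + 1) * t := by gcongr
    _ < ε / (t + 1) * (t + 1) := by gcongr; linarith
    _ = ε := by field_simp

/-- The partial sums of a bounded periodic sequence grow linearly, with a bounded error. -/
lemma abs_sum_range_sub_of_periodic {Ψ : ℕ → ℝ} {α : ℕ} (hα : 0 < α)
    (hper : Function.Periodic Ψ α) {M : ℝ} (hM : ∀ i, |Ψ i| ≤ M) (N : ℕ) :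
    |∑ i ∈ Finset.range N, Ψ i - N * (1 / α * ∑ i ∈ Finset.range α, Ψ i)| ≤ 2 * α * M := by
  have hα' : (0 : ℝ) < α := by exact_mod_cast hα
  have hbound : ∀ n : ℕ, |∑ i ∈ Finset.range n, Ψ i| ≤ n * M := fun n => by
    refine (Finset.abs_sum_le_sum_abs _ _).trans ((Finset.sum_le_sum fun i _ => hM i).trans_eq ?_)
    simp
  have hM0 : 0 ≤ M := (abs_nonneg _).trans (hM 0)
  induction N using Nat.strong_induction_on with
  | _ N ih =>
    rcases lt_or_ge N α with hN | hN
    · have hN' : (N : ℝ) ≤ α := by exact_mod_cast hN.le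
      have h2 : |(N : ℝ) * (1 / α * ∑ i ∈ Finset.range α, Ψ i)| ≤ N * M := by
        rw [abs_mul, abs_mul, Nat.abs_cast, abs_of_pos (by positivity : (0 : ℝ) < 1 / α)]
        gcongr
        rw [one_div_mul_eq_div, div_le_iff₀ hα', mul_comm]
        exact hbound α
      calc _ ≤ N * M + N * M := (abs_sub _ _).trans (add_le_add (hbound N) h2)
        _ = 2 * N * M := by ring
        _ ≤ 2 * α * M := by gcongr
    · obtain ⟨m, rfl⟩ := Nat.exists_eq_add_of_le hN
      convert ih m (by omega) using 2
      rw [Finset.sum_range_add]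
      have : ∀ i, Ψ (α + i) = Ψ i := fun i => by rw [add_comm]; exact hper i
      simp_rw [this]
      push_cast
      field_simp
      ring

lemma sum_range_mul_of_periodic {Ψ : ℕ → ℝ} {α : ℕ} (hper : Function.Periodic Ψ α) (k : ℕ) :
    ∑ i ∈ Finset.range (k * α), Ψ i = k * ∑ i ∈ Finset.range α, Ψ i := by
  induction k with
  | zero => simp
  | succ k ih =>
    have : ∀ i, Ψ (k * α + i) = Ψ i := fun i => by rw [add_comm]; exact hper.nat_mul k i
    rw [Nat.succ_mul, Finset.sum_range_add, ih]
    simp_rw [this]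
    push_cast
    ring

lemma sum_range_natCast_zmod {α : ℕ} [NeZero α] (f : ZMod α → ℝ) :
    ∑ i ∈ Finset.range α, f (i : ZMod α) = ∑ z : ZMod α, f z :=
  Finset.sum_nbij' (fun i => (i : ZMod α)) ZMod.val (by simp)
    (fun z _ => Finset.mem_range.2 (ZMod.val_lt z))
    (fun i hi => ZMod.val_cast_of_lt (Finset.mem_range.1 hi)) (by simp) (by simp)

/-- Multiplication by a number prime to `α` permutes the residues modulo `α`. -/
lemma sum_range_coprime_mul {h : ℝ → ℝ} (hper : ∀ x (k : ℤ), h (x + k) = h x) {α β : ℕ}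
    (hα : 0 < α) (hco : Nat.Coprime β α) :
    ∑ i ∈ Finset.range α, h ((β : ℝ) / α * (i + 1)) =
      ∑ i ∈ Finset.range α, h (((i : ℝ) + 1) / α) := by
  have : NeZero α := ⟨hα.ne'⟩
  have hα' : (α : ℝ) ≠ 0 := by exact_mod_cast hα.ne'
  let φ : ZMod α → ℝ := fun z => h ((z.val : ℝ) / α)
  have hφ : ∀ n : ℕ, φ (n : ZMod α) = h ((n : ℝ) / α) := fun n => by
    have e : (n : ℝ) = ((n % α : ℕ) : ℝ) + α * ((n / α : ℕ) : ℝ) := by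
      exact_mod_cast (Nat.mod_add_div n α).symm
    have : (n : ℝ) / α = ((n % α : ℕ) : ℝ) / α + (((n / α : ℕ) : ℤ) : ℝ) := by
      rw [Int.cast_natCast]
      nth_rewrite 1 [e]
      field_simp
    simp only [φ, ZMod.val_natCast]
    rw [this, hper]
  have h1 : ∀ i : ℕ, h ((β : ℝ) / α * (i + 1)) = φ ((β : ZMod α) * ((i : ZMod α) + 1)) :=
    fun i => by
      have := hφ (β * (i + 1))
      push_cast at this
      rw [this]
      congr 1
      ring
  have h2 : ∀ i : ℕ, h (((i : ℝ) + 1) / α) = φ ((i : ZMod α) + 1) := fun i => by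
    simpa using (hφ (i + 1)).symm
  simp_rw [h1, h2]
  rw [sum_range_natCast_zmod fun z => φ ((β : ZMod α) * (z + 1)),
    sum_range_natCast_zmod fun z => φ (z + 1),
    show ∑ z, φ (z + 1) = ∑ z, φ z from Equiv.sum_comp (Equiv.addRight 1) φ,
    show ∑ z, φ ((β : ZMod α) * (z + 1)) = ∑ z, φ ((β : ZMod α) * z) from
      Equiv.sum_comp (Equiv.addRight 1) fun z => φ ((β : ZMod α) * z)]
  exact Equiv.sum_comp (Units.mulLeft (ZMod.unitOfCoprime β hco)) φ

lemma periodic_rational_samples {h : ℝ → ℝ} (hper : ∀ x (k : ℤ), h (x + k) = h x) {α : ℕ}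
    (hα : 0 < α) (β : ℕ) : Function.Periodic (fun i : ℕ => h ((β : ℝ) / α * (i + 1))) α := by
  intro i
  have hα' : (α : ℝ) ≠ 0 := by exact_mod_cast hα.ne'
  have := hper ((β : ℝ) / α * (i + 1)) β
  simp only
  rw [← this]
  congr 1
  push_cast
  field_simp
  ring

/-- Reduced denominators of rationals converging to `L` without reaching it tend to infinity. -/
lemma tendsto_reduced_denom {a b : ℕ → ℕ} (ha_pos : ∀ n, 0 < a n) {L : ℝ}
    (hlim : Tendsto (fun n => (b n : ℝ) / (a n : ℝ)) atTop (𝓝 L))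
    (hne : ∀ᶠ n in atTop, (b n : ℝ) / (a n : ℝ) ≠ L) :
    Tendsto (fun n => a n / Nat.gcd (a n) (b n)) atTop atTop := by
  have havoid : ∀ d : ℕ, 0 < d → ∀ᶠ n in atTop, a n / Nat.gcd (a n) (b n) ≠ d := by
    intro d hd
    have hdl : Tendsto (fun n => (d : ℝ) * ((b n : ℝ) / a n)) atTop (𝓝 (d * L)) :=
      hlim.const_mul _
    -- Near `d * L` there is no integer except possibly `d * L` itself.
    have hlow : ((⌈(d : ℝ) * L⌉ : ℝ) - 1) < d * L := by linarith [Int.ceil_lt_add_one ((d : ℝ) * L)]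
    have hup := Int.lt_floor_add_one ((d : ℝ) * L)
    filter_upwards [hne, hdl.eventually_const_lt hlow, hdl.eventually_lt_const hup]
      with n hn h1 h2 heq
    have hg : 0 < Nat.gcd (a n) (b n) := Nat.gcd_pos_of_pos_left _ (ha_pos n)
    have hz : (d : ℝ) * ((b n : ℝ) / a n) = ((b n / Nat.gcd (a n) (b n) : ℕ) : ℤ) := by
      have ea : a n = d * Nat.gcd (a n) (b n) := by
        rw [← heq, Nat.div_mul_cancel (Nat.gcd_dvd_left _ _)]
      have eb : b n = (b n / Nat.gcd (a n) (b n)) * Nat.gcd (a n) (b n) :=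
        (Nat.div_mul_cancel (Nat.gcd_dvd_right _ _)).symm
      have ea' : (a n : ℝ) = d * (Nat.gcd (a n) (b n) : ℝ) := by exact_mod_cast ea
      have eb' : (b n : ℝ) = ((b n / Nat.gcd (a n) (b n) : ℕ) : ℝ) * (Nat.gcd (a n) (b n) : ℝ) := by
        exact_mod_cast eb
      have hg' : (Nat.gcd (a n) (b n) : ℝ) ≠ 0 := by exact_mod_cast hg.ne'
      have hd' : (d : ℝ) ≠ 0 := by exact_mod_cast hd.ne'
      rw [Int.cast_natCast, ea']
      nth_rewrite 1 [eb']
      field_simp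
    generalize ((b n / Nat.gcd (a n) (b n) : ℕ) : ℤ) = z at hz
    rw [hz] at h1 h2
    have hz1 : ⌈(d : ℝ) * L⌉ ≤ z := by
      have : ⌈(d : ℝ) * L⌉ - 1 < z := by exact_mod_cast h1
      omega
    have hz2 : z ≤ ⌊(d : ℝ) * L⌋ := by
      have : z < ⌊(d : ℝ) * L⌋ + 1 := by exact_mod_cast h2
      omega
    have hzL : (z : ℝ) = d * L := le_antisymm (Int.le_floor.1 hz2) (Int.ceil_le.1 hz1)
    have hd' : (d : ℝ) ≠ 0 := by exact_mod_cast hd.ne'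
    exact hn (mul_left_cancel₀ hd' (hz.trans hzL))
  refine tendsto_atTop.2 fun K => ?_
  have hall : ∀ᶠ n in atTop, ∀ d ∈ Finset.Ico 1 K, a n / Nat.gcd (a n) (b n) ≠ d :=
    (Filter.eventually_all_finset _).2 fun d hd => havoid d (Finset.mem_Ico.1 hd).1
  filter_upwards [hall] with n hn
  have hpos : 0 < a n / Nat.gcd (a n) (b n) :=
    Nat.div_pos (Nat.gcd_le_left _ (ha_pos n)) (Nat.gcd_pos_of_pos_left _ (ha_pos n))
  by_contra hlt
  exact hn _ (Finset.mem_Ico.2 ⟨hpos, not_le.1 hlt⟩) rfl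

/-! ### Reduction to averages of `f_L` -/

lemma tendsto_boundary_average {l : ℝ} (hl : 0 < l) {a : ℕ → ℕ} (ha : Tendsto a atTop atTop)
    (t : ℝ) :
    Tendsto (fun n => 1 / (a n : ℝ) * ∑ i ∈ Finset.range ⌊(a n : ℝ) * t⌋₊, 4 / (2 * (l * i) + 1))
      atTop (𝓝 0) := by
  obtain ⟨T, hT⟩ := exists_nat_gt t
  have hT1 : t ≤ (T + 1 : ℕ) := by push_cast; linarith
  have hu : Tendsto (fun i : ℕ => 4 / (2 * (l * (i : ℝ)) + 1)) atTop (𝓝 0) := by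
    refine Tendsto.div_atTop tendsto_const_nhds (tendsto_atTop_add_const_right _ _ ?_)
    exact (tendsto_natCast_atTop_atTop.const_mul_atTop hl).const_mul_atTop two_pos
  have hmul : Tendsto (fun n => (T + 1) * a n) atTop atTop :=
    ha.const_mul_atTop' (Nat.succ_pos T)
  have h := (hu.cesaro.comp hmul).const_mul ((T + 1 : ℕ) : ℝ)
  rw [mul_zero] at h
  refine squeeze_zero' (Eventually.of_forall fun n => by positivity) ?_ h
  filter_upwards [ha.eventually_gt_atTop 0] with n hn
  have hn' : (0 : ℝ) < a n := by exact_mod_cast hn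
  have hle : ⌊(a n : ℝ) * t⌋₊ ≤ (T + 1) * a n := by
    refine Nat.floor_le_of_le ?_
    push_cast at hT1 ⊢
    nlinarith
  have hsum : ∑ i ∈ Finset.range ⌊(a n : ℝ) * t⌋₊, 4 / (2 * (l * (i : ℝ)) + 1) ≤
      ∑ i ∈ Finset.range ((T + 1) * a n), 4 / (2 * (l * (i : ℝ)) + 1) :=
    Finset.sum_le_sum_of_subset_of_nonneg (Finset.range_mono hle) fun i _ _ => by positivity
  calc _ ≤ 1 / (a n : ℝ) * ∑ i ∈ Finset.range ((T + 1) * a n), 4 / (2 * (l * (i : ℝ)) + 1) := by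
        gcongr
    _ = _ := by
        simp only [Function.comp_apply]
        push_cast
        field_simp

/-- The mean of `W_a(t) W_b(t)` is governed by the averages of `f_L` over the points `(b / a) i`,
`1 ≤ i ≤ at`: extending the inner sums to all of `ℤ`, replacing `f_{b/a}` by `f_L`, and dropping the
terms linear in the covariances all cost `o(1)`. -/
lemma IsFBMSixth.tendsto_integral_of_average {Ω : Type*} [MeasurableSpace Ω] {P : Measure Ω}
    {B : ℝ → Ω → ℝ} (hB : IsFBMSixth P B) {a b : ℕ → ℕ} (ha : Tendsto a atTop atTop)
    (hb : Tendsto b atTop atTop) {L : ℝ} (hL : 0 < L)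
    (hlim : Tendsto (fun n => (b n : ℝ) / (a n : ℝ)) atTop (𝓝 L)) {t : ℝ} (ht : 0 ≤ t) {V : ℝ}
    (hV : Tendsto (fun n => 1 / (a n : ℝ) * ∑ i ∈ Finset.range ⌊(a n : ℝ) * t⌋₊,
      fSum L ((b n : ℝ) / a n * (i + 1))) atTop (𝓝 V)) :
    Tendsto (fun n => ∫ ω, cubicVar B (a n) t ω * cubicVar B (b n) t ω ∂P) atTop
      (𝓝 (3 / (4 * L) * V)) := by
  have ha0 := ha.eventually_gt_atTop 0
  have hb0 := hb.eventually_gt_atTop 0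
  have hfloor : ∀ n : ℕ, (⌊(n : ℝ) * t⌋₊ : ℝ) ≤ n * t := fun n => Nat.floor_le (by positivity)
  have h1 : Tendsto (fun n => 1 / (a n : ℝ) * ∑ i ∈ Finset.range ⌊(a n : ℝ) * t⌋₊,
      fSum ((b n : ℝ) / a n) ((b n : ℝ) / a n * (i + 1))) atTop (𝓝 V) := by
    refine tendsto_of_tendsto_of_dist hV (Metric.tendsto_nhds.2 fun ε hε => ?_)
    filter_upwards [ha0, eventually_abs_fSum_sub_lt hlim (show 0 < ε / (t + 1) by positivity)]
      with n hn hd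
    have hn' : (0 : ℝ) < a n := by exact_mod_cast hn
    rw [dist_zero_right, Real.norm_of_nonneg dist_nonneg, Real.dist_eq, ← mul_sub,
      ← Finset.sum_sub_distrib, abs_mul, abs_of_pos (by positivity : 0 < 1 / (a n : ℝ))]
    calc _ ≤ 1 / (a n : ℝ) * ∑ i ∈ Finset.range ⌊(a n : ℝ) * t⌋₊, ε / (t + 1) := by
          gcongr
          refine (Finset.abs_sum_le_sum_abs _ _).trans (Finset.sum_le_sum fun i _ => ?_)
          rw [abs_sub_comm]
          exact (hd _).le
      _ = 1 / (a n : ℝ) * (⌊(a n : ℝ) * t⌋₊ * (ε / (t + 1))) := by simp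
      _ ≤ 1 / (a n : ℝ) * (a n * t * (ε / (t + 1))) := by gcongr; exact hfloor _
      _ = t * (ε / (t + 1)) := by field_simp
      _ < (t + 1) * (ε / (t + 1)) := by gcongr; linarith
      _ = ε := by field_simp
  have h2 : Tendsto (fun n => 1 / (a n : ℝ) * ∑ i ∈ Finset.range ⌊(a n : ℝ) * t⌋₊,
      ∑ j ∈ Finset.range ⌊(b n : ℝ) * t⌋₊, fbmKernel ((b n : ℝ) / a n) (j - (b n : ℝ) / a n * i))
      atTop (𝓝 V) := by
    have hbd := (tendsto_boundary_average (half_pos hL) ha t).const_mul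
      (4 * (24 + 16 * (2 * L) ^ 2))
    rw [mul_zero] at hbd
    refine tendsto_of_tendsto_of_dist h1 (squeeze_zero' (Eventually.of_forall fun _ => dist_nonneg)
      ?_ hbd)
    filter_upwards [ha0, hlim.eventually_const_lt (half_lt_self hL),
      hlim.eventually_lt_const (show L < 2 * L by linarith)] with n hn hl hu
    have hn' : (0 : ℝ) < a n := by exact_mod_cast hn
    have hJ : (b n : ℝ) / a n * ⌊(a n : ℝ) * t⌋₊ ≤ ⌊(b n : ℝ) * t⌋₊ + 1 := by
      calc (b n : ℝ) / a n * ⌊(a n : ℝ) * t⌋₊ ≤ (b n : ℝ) / a n * (a n * t) := by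
            gcongr; exact hfloor _
        _ = b n * t := by field_simp
        _ ≤ _ := (Nat.lt_floor_add_one _).le
    have hK : ∀ u, |fbmKernel ((b n : ℝ) / a n) u| ≤
        (24 + 16 * (2 * L) ^ 2) * (1 / (1 + u ^ 2)) := fun u => by
      rw [mul_one_div]
      refine (abs_fbmKernel_le _ u).trans ?_
      gcongr
    rw [dist_comm, Real.dist_eq, ← mul_sub, abs_mul,
      abs_of_pos (by positivity : 0 < 1 / (a n : ℝ)), mul_left_comm]
    gcongr
    exact abs_sum_sum_fbmKernel_sub_le (by positivity) hK (half_pos hL) hl.le hJ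
  have hinv : ∀ c : ℕ → ℕ, Tendsto c atTop atTop →
      Tendsto (fun n => (1 / (c n : ℝ)) ^ (1 / 3 : ℝ)) atTop (𝓝 0) := fun c hc => by
    have h0 : Tendsto (fun n => 1 / (c n : ℝ)) atTop (𝓝 0) :=
      tendsto_const_nhds.div_atTop (tendsto_natCast_atTop_atTop.comp hc)
    have := h0.rpow_const (p := 1 / 3) (Or.inr (by norm_num))
    rwa [Real.zero_rpow (by norm_num)] at this
  have hquot : ∀ c : ℕ → ℕ, Tendsto c atTop atTop →
      Tendsto (fun n => (⌊(c n : ℝ) * t⌋₊ : ℝ) / c n) atTop (𝓝 t) := fun c hc => by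
    have := (tendsto_nat_floor_mul_div_atTop ht).comp
      (tendsto_natCast_atTop_atTop (R := ℝ) |>.comp hc)
    simpa only [Function.comp_def, mul_comm t] using this
  have hΦ : Continuous fun z : ℝ × ℝ => fbmPhi 0 z.1 0 z.2 := by
    have h := continuous_abs_rpow_third
    unfold fbmPhi
    refine ((Continuous.add ?_ ?_).sub ?_).sub ?_
    all_goals exact h.comp (by fun_prop)
  have h3 := (((hinv a ha).mul (hinv b hb)).const_mul (9 / 2)).mul
    ((hΦ.tendsto (t, t)).comp ((hquot a ha).prodMk_nhds (hquot b hb)))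
  have h4 := (((hlim.inv₀ hL.ne').mul h2).const_mul (3 / 4)).add h3
  have hval : 3 / 4 * (L⁻¹ * V) + 9 / 2 * (0 * 0) * fbmPhi 0 t 0 t = 3 / (4 * L) * V := by
    field_simp
    ring
  simp only [hval] at h4
  refine h4.congr' ?_
  filter_upwards [ha0, hb0] with n hn hn'
  have hn1 : (a n : ℝ) ≠ 0 := by exact_mod_cast hn.ne'
  rw [hB.integral_cubicVar_mul hn hn', inv_div, ← mul_assoc ((a n : ℝ) / b n),
    show (a n : ℝ) / b n * (1 / a n) = 1 / b n by field_simp]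
  rfl

/-- Averages of a bounded function of period one over the multiples of a fraction `β / α` in lowest
terms are its averages over the `α`-th parts of the period, up to an error of order `α / A`, and
exactly so if whole periods are summed. -/
lemma tendsto_average_of_reduced {h : ℝ → ℝ} (hper : ∀ x (k : ℤ), h (x + k) = h x) {M : ℝ}
    (hM : ∀ x, |h x| ≤ M) {a α β : ℕ → ℕ} (ha : Tendsto a atTop atTop)
    (hα : ∀ᶠ n in atTop, 0 < α n) (hco : ∀ᶠ n in atTop, Nat.Coprime (β n) (α n))
    {t : ℝ} (ht : 0 ≤ t)
    (herr : Tendsto (fun n => (α n : ℝ) / a n) atTop (𝓝 0) ∨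
      ∀ᶠ n in atTop, α n ∣ ⌊(a n : ℝ) * t⌋₊) {V : ℝ}
    (hV : Tendsto (fun n => 1 / (α n : ℝ) * ∑ i ∈ Finset.range (α n), h ((i + 1) / α n)) atTop
      (𝓝 V)) :
    Tendsto (fun n => 1 / (a n : ℝ) * ∑ i ∈ Finset.range ⌊(a n : ℝ) * t⌋₊,
      h ((β n : ℝ) / α n * (i + 1))) atTop (𝓝 (t * V)) := by
  have hquot : Tendsto (fun n => (⌊(a n : ℝ) * t⌋₊ : ℝ) / a n) atTop (𝓝 t) := by
    have := (tendsto_nat_floor_mul_div_atTop ht).comp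
      (tendsto_natCast_atTop_atTop (R := ℝ) |>.comp ha)
    simpa only [Function.comp_def, mul_comm t] using this
  have hmain := hquot.mul hV
  rcases herr with herr | hdvd
  · have herr' := herr.mul_const (2 * M)
    rw [zero_mul] at herr'
    refine tendsto_of_tendsto_of_dist hmain (squeeze_zero' (Eventually.of_forall fun _ =>
      dist_nonneg) ?_ herr')
    filter_upwards [hα, hco] with n hn hc
    have hb := abs_sum_range_sub_of_periodic hn (periodic_rational_samples hper hn (β n))
      (fun i => hM _) ⌊(a n : ℝ) * t⌋₊
    rw [sum_range_coprime_mul hper hn hc] at hb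
    generalize 1 / (α n : ℝ) * ∑ i ∈ Finset.range (α n), h ((i + 1) / α n) = R at *
    rw [dist_comm, Real.dist_eq]
    calc _ = |1 / (a n : ℝ) * (∑ i ∈ Finset.range ⌊(a n : ℝ) * t⌋₊,
            h ((β n : ℝ) / α n * (i + 1)) - ⌊(a n : ℝ) * t⌋₊ * R)| := by congr 1; ring
      _ ≤ 1 / (a n : ℝ) * (2 * α n * M) := by
          rw [abs_mul, abs_of_nonneg (by positivity : 0 ≤ 1 / (a n : ℝ))]
          gcongr
      _ = (α n : ℝ) / a n * (2 * M) := by ring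
  · refine hmain.congr' ?_
    filter_upwards [hα, hco, hdvd] with n hn hc ⟨k, hk⟩
    have hn' : (α n : ℝ) ≠ 0 := by exact_mod_cast hn.ne'
    rw [hk, mul_comm (α n) k,
      sum_range_mul_of_periodic (periodic_rational_samples hper hn (β n)),
      sum_range_coprime_mul hper hn hc]
    push_cast
    field_simp

/-! ### The limits -/

lemma div_gcd_div_div_gcd {a b : ℕ} (ha : 0 < a) :
    ((b / Nat.gcd a b : ℕ) : ℝ) / ((a / Nat.gcd a b : ℕ) : ℝ) = (b : ℝ) / a := by
  have hg : (Nat.gcd a b : ℝ) ≠ 0 := by exact_mod_cast (Nat.gcd_pos_of_pos_left b ha).ne'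
  rw [Nat.cast_div (Nat.gcd_dvd_right a b) hg, Nat.cast_div (Nat.gcd_dvd_left a b) hg,
    div_div_div_cancel_right₀ hg]

/-- If `b n / a n → L` without reaching `L`, the sampling points `(b n / a n) i` run through finer
and finer equidistant partitions of the period. -/
lemma tendsto_average_fSum_of_ne {a b : ℕ → ℕ} (ha : Tendsto a atTop atTop)
    (ha_pos : ∀ n, 0 < a n) {L : ℝ} (hlim : Tendsto (fun n => (b n : ℝ) / (a n : ℝ)) atTop (𝓝 L))
    (hne : ∀ᶠ n in atTop, (b n : ℝ) / (a n : ℝ) ≠ L) {t : ℝ} (ht : 0 ≤ t)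
    (herr : Tendsto (fun n => ((a n / Nat.gcd (a n) (b n) : ℕ) : ℝ) / a n) atTop (𝓝 0) ∨
      ∀ᶠ n in atTop, a n / Nat.gcd (a n) (b n) ∣ ⌊(a n : ℝ) * t⌋₊) :
    Tendsto (fun n => 1 / (a n : ℝ) * ∑ i ∈ Finset.range ⌊(a n : ℝ) * t⌋₊,
      fSum L ((b n : ℝ) / a n * (i + 1))) atTop (𝓝 (t * ∫ x in (0 : ℝ)..1, fSum L x)) := by
  obtain ⟨M, hM⟩ := exists_abs_fSum_le L
  have hV := tendsto_riemann_sum (continuous_fSum_right L) (tendsto_reduced_denom ha_pos hlim hne)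
    zero_le_one
  simp only [mul_one, Nat.floor_natCast] at hV
  have hg : ∀ n, 0 < Nat.gcd (a n) (b n) := fun n => Nat.gcd_pos_of_pos_left _ (ha_pos n)
  have h := tendsto_average_of_reduced (fSum_add_intCast L) hM
    (β := fun n => b n / Nat.gcd (a n) (b n)) ha
    (Eventually.of_forall fun n => Nat.div_pos (Nat.gcd_le_left _ (ha_pos n)) (hg n))
    (Eventually.of_forall fun n => (Nat.coprime_div_gcd_div_gcd (hg n)).symm) ht herr hV
  refine h.congr fun n => ?_
  simp_rw [div_gcd_div_div_gcd (ha_pos n)]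

theorem theorem3p7 {Ω : Type*} [MeasurableSpace Ω] (P : Measure Ω) [IsProbabilityMeasure P]
    (B : ℝ → Ω → ℝ) (hB : IsFBMSixth P B)
    (a b : ℕ → ℕ) (ha : StrictMono a) (hb : StrictMono b)
    (ha_pos : ∀ n, 0 < a n) (hb_pos : ∀ n, 0 < b n)
    (L : ℝ) (hL : 0 < L)
    (hlim : Tendsto (fun n => (b n : ℝ) / (a n : ℝ)) atTop (𝓝 L)) :
    -- the expectations and the function `f_L` in the limits below are well defined
    (∀ n : ℕ, ∀ t : ℝ, 0 ≤ t →
      Integrable (fun ω => cubicVar B (a n) t ω * cubicVar B (b n) t ω) P) ∧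
    (∀ x ∈ Set.Icc (0 : ℝ) 1, Summable (fun m : ℤ => fTerm L m x)) ∧
    ContinuousOn (fSum L) (Set.Icc 0 1) ∧
    -- (i)
    ({n : ℕ | (b n : ℝ) / (a n : ℝ) = L}ᶜ.Finite →
      (∃ r : ℚ, (r : ℝ) = L) ∧
      ∀ p q : ℕ, 0 < p → 0 < q → Nat.Coprime p q → L = (p : ℝ) / (q : ℝ) →
        ∀ t : ℝ, 0 ≤ t →
          Tendsto (fun n => ∫ ω, cubicVar B (a n) t ω * cubicVar B (b n) t ω ∂P) atTop
            (𝓝 (3 * t / (4 * (p : ℝ)) *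
              ∑ j ∈ Finset.Icc 1 q, fSum L ((j : ℝ) / (q : ℝ))))) ∧
    -- (ii)
    ({n : ℕ | (b n : ℝ) / (a n : ℝ) = L}.Finite →
      Tendsto (fun n => ∫ ω, cubicVar B (a n) 1 ω * cubicVar B (b n) 1 ω ∂P) atTop
        (𝓝 (3 / (4 * L) * ∫ x in (0 : ℝ)..1, fSum L x))) ∧
    -- (iii)
    ({n : ℕ | (b n : ℝ) / (a n : ℝ) = L}.Finite →
      Tendsto (fun n => Nat.gcd (a n) (b n)) atTop atTop →
      ∀ t : ℝ, 0 ≤ t →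
        Tendsto (fun n => ∫ ω, cubicVar B (a n) t ω * cubicVar B (b n) t ω ∂P) atTop
          (𝓝 (3 * t / (4 * L) * ∫ x in (0 : ℝ)..1, fSum L x))) ∧
    -- (iv)
    (∀ k : ℕ, (∀ n, b n ≡ k [MOD a n]) →
      ∀ t : ℝ, 0 ≤ t →
        Tendsto (fun n => ∫ ω, cubicVar B (a n) t ω * cubicVar B (b n) t ω ∂P) atTop
          (𝓝 (3 / (4 * L) * ∫ x in (0 : ℝ)..t, fHat L ((k : ℝ) * x)))) := by
  have ha' : Tendsto a atTop atTop := ha.tendsto_atTop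
  have hb' : Tendsto b atTop atTop := hb.tendsto_atTop
  have haR : Tendsto (fun n => (a n : ℝ)) atTop atTop := tendsto_natCast_atTop_atTop.comp ha'
  refine ⟨fun n t _ => hB.integrable_cubicVar_mul _ _ _, fun x _ => summable_fTerm L x,
    (continuous_fSum_right L).continuousOn, ?_, ?_, ?_, ?_⟩
  · intro hfin
    have hev : ∀ᶠ n in atTop, (b n : ℝ) / a n = L := by
      rw [← Nat.cofinite_eq_atTop]
      exact hfin
    refine ⟨?_, fun p q hp hq hpq hLpq t ht => ?_⟩
    · obtain ⟨n, hn⟩ := hev.exists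
      exact ⟨(b n : ℚ) / a n, by push_cast; exact hn⟩
    obtain ⟨M, hM⟩ := exists_abs_fSum_le L
    have havg := tendsto_average_of_reduced (fSum_add_intCast L) hM (α := fun _ => q)
      (β := fun _ => p) ha' (Eventually.of_forall fun _ => hq) (Eventually.of_forall fun _ => hpq)
      ht (Or.inl (tendsto_const_nhds.div_atTop haR)) tendsto_const_nhds
    have h := hB.tendsto_integral_of_average ha' hb' hL hlim ht
      (havg.congr' (hev.mono fun n hn => by simp only [hn, ← hLpq]))
    convert h using 2
    have hsum : ∑ j ∈ Finset.Icc 1 q, fSum L ((j : ℝ) / q) =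
        ∑ i ∈ Finset.range q, fSum L (((i : ℝ) + 1) / q) := by
      have := Finset.sum_Ico_add' (fun j : ℕ => fSum L ((j : ℝ) / q)) 0 q 1
      rw [← Finset.Ico_add_one_right_eq_Icc, Finset.range_eq_Ico, ← this]
      simp
    rw [hsum]
    generalize ∑ i ∈ Finset.range q, fSum L (((i : ℝ) + 1) / q) = S
    rw [hLpq]
    have hp' : (p : ℝ) ≠ 0 := by exact_mod_cast hp.ne'
    have hq' : (q : ℝ) ≠ 0 := by exact_mod_cast hq.ne'
    field_simp
  · intro hfin
    have hne : ∀ᶠ n in atTop, (b n : ℝ) / a n ≠ L := by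
      rw [← Nat.cofinite_eq_atTop]
      exact hfin.compl_mem_cofinite
    have h := hB.tendsto_integral_of_average ha' hb' hL hlim zero_le_one
      (tendsto_average_fSum_of_ne ha' ha_pos hlim hne zero_le_one
        (Or.inr (Eventually.of_forall fun n => by
          rw [mul_one, Nat.floor_natCast]
          exact Nat.div_dvd_of_dvd (Nat.gcd_dvd_left _ _))))
    rwa [one_mul] at h
  · intro hfin hgcd t ht
    have hne : ∀ᶠ n in atTop, (b n : ℝ) / a n ≠ L := by
      rw [← Nat.cofinite_eq_atTop]
      exact hfin.compl_mem_cofinite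
    have herr : Tendsto (fun n => ((a n / Nat.gcd (a n) (b n) : ℕ) : ℝ) / a n) atTop (𝓝 0) := by
      refine (tendsto_const_nhds (x := (1 : ℝ)).div_atTop
        (tendsto_natCast_atTop_atTop.comp hgcd)).congr fun n => ?_
      have hg : (Nat.gcd (a n) (b n) : ℝ) ≠ 0 := by
        exact_mod_cast (Nat.gcd_pos_of_pos_left (b n) (ha_pos n)).ne'
      have han : (a n : ℝ) ≠ 0 := by exact_mod_cast (ha_pos n).ne'
      rw [Nat.cast_div (Nat.gcd_dvd_left _ _) hg, Function.comp_apply]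
      field_simp
    have h := hB.tendsto_integral_of_average ha' hb' hL hlim ht
      (tendsto_average_fSum_of_ne ha' ha_pos hlim hne ht (Or.inl herr))
    convert h using 2
    ring
  · intro k hk t ht
    simp_rw [fHat_eq_fSum]
    have hcont : Continuous fun x : ℝ => fSum L ((k : ℝ) * x) :=
      (continuous_fSum_right L).comp (continuous_const_mul (k : ℝ))
    refine hB.tendsto_integral_of_average ha' hb' hL hlim ht
      ((tendsto_riemann_sum hcont ha' ht).congr fun n => ?_)
    congr 1
    refine Finset.sum_congr rfl fun i _ => ?_
    -- `b n` and `k` differ by a multiple of `a n`, so the two arguments differ by an integer.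
    obtain ⟨c, hc⟩ := (Nat.modEq_iff_dvd.1 (hk n).symm)
    have hc' : (b n : ℝ) - k = a n * c := by exact_mod_cast hc
    have han : (a n : ℝ) ≠ 0 := by exact_mod_cast (ha_pos n).ne'
    rw [← fSum_add_intCast L _ (c * (i + 1)), ← sub_add_cancel (b n : ℝ) k, hc']
    congr 1
    push_cast
    field_simp
    ring
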